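/- Let $d\ge 1$. Let $\mu$ be a probability measure on $\{0,1,2,\dots\}$ with mean $1$ and some finite exponential moment ($\sum_n \mu(n)e^{an}<\infty$ for some $a>0$), and let $\theta$ be a centered probability measure on $\mathbb Z^d$ whose support is exactly the set $\{z\in\mathbb Z^d:\|z\|=1\}$ of neighbours of the origin, where $\|\cdot\|$ is the Euclidean norm. Let $\mathcal T$ be a Bienaymé–Galton–Watson tree with offspring distribution $\mu$ and, independently of it, let $(X_e)$ be i.i.d. random variables with law $\theta$, indexed by the edges of the tree. Under $\mathbb P_x$, the branching random walk starts from $S_\emptyset=x$, and for $u\in\mathcal T$ we let $S_u=x+\sum_e X_e$, the sum being over the edges $e$ of the path from the root $\emptyset$ to $u$. For $r>0$ let $B_r=\{z\in\mathbb Z^d:\|z\|<r\}$, and let $\mathcal T(B_r)$ be the set of those $u\in\mathcal T$ such that $S_v\in B_r$ for every ancestor $v$ of $u$, $u$ itself included. Then there exist constants $c>0$ and $C>0$ (depending only on $d$, $\mu$ and $\theta$) such that, for all real $r\ge 1$ and all real $t\ge r^4$, $$\sup_{x\in B_r}\mathbb P_x\big(|\mathcal T(B_r)|>t\big)\le \frac{C}{r^2}\exp\Big(-\frac{c\,t}{r^4}\Big).$$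 -/

import Mathlib

open MeasureTheory
open scoped ENNReal

noncomputable section

namespace BRW

/-- Euclidean norm of a point of the lattice `ℤ^d`. -/
def eucNorm {d : ℕ} (z : Fin d → ℤ) : ℝ :=
  ‖(WithLp.toLp 2 (fun i => (z i : ℝ)) : EuclideanSpace ℝ (Fin d))‖

/-- The open Euclidean ball `B_r = {z ∈ ℤ^d : ‖z‖ < r}`. -/
def ball (d : ℕ) (r : ℝ) : Set (Fin d → ℤ) := {z | eucNorm z < r}

/-- Offspring distributions: probability measures on `ℕ` with mean one and some finite
exponential moment. (The mean is a Bochner integral, but its value is `1`, so that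
integrability is part of the condition.) -/
structure IsOffspringLaw (μ : Measure ℕ) : Prop where
  isProbabilityMeasure : IsProbabilityMeasure μ
  critical : ∫ n, (n : ℝ) ∂μ = 1
  exp_moment : ∃ a : ℝ, 0 < a ∧ Integrable (fun n : ℕ => Real.exp (a * (n : ℝ))) μ

/-- Jump distributions: centered probability measures on `ℤ^d` whose support is exactly the set
of neighbours of the origin. -/
structure IsJumpLaw {d : ℕ} (θ : Measure (Fin d → ℤ)) : Prop where
  isProbabilityMeasure : IsProbabilityMeasure θ
  support : ∀ z : Fin d → ℤ, θ {z} ≠ 0 ↔ eucNorm z = 1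
  centered : ∀ i : Fin d, ∫ z, (z i : ℝ) ∂θ = 0

/-- Potential individuals carry Ulam–Harris labels: the root is `[]`, the children of `v` are
`v ++ [0], v ++ [1], …`, and `v` is an ancestor of `u` (or `u` itself) iff `v <+: u`. -/
abbrev Label : Type := List ℕ

/-- The sample space: every label `u` carries a pair `(ξ_u, X_u)`, where `ξ_u` is the number of
children of `u` and `X_u` is the jump along the edge from the parent of `u` to `u` (the jump
carried by the root is not used). -/
abbrev Env (d : ℕ) : Type := Label → ℕ × (Fin d → ℤ)

/-- The law of the environment: all the `ξ_u` and `X_u` are independent, `ξ_u` has law `μ` and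
`X_u` has law `θ`. -/
def law {d : ℕ} (μ : Measure ℕ) (θ : Measure (Fin d → ℤ)) : Measure (Env d) :=
  Measure.infinitePi (fun _ : Label => μ.prod θ)

/-- The Bienaymé–Galton–Watson tree: `u` is alive iff, for each vertex `v ++ [i]` on the path from
the root to `u`, the index `i` is less than the number of children of `v`. -/
def tree {d : ℕ} (ω : Env d) : Set Label :=
  {u | ∀ (v : Label) (i : ℕ), v ++ [i] <+: u → i < (ω v).1}

/-- The position `S_u` of `u` for the branching random walk started from `x`: the starting point
plus the sum of the jumps along the edges of the path from the root to `u`. -/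
def position {d : ℕ} (x : Fin d → ℤ) (ω : Env d) (u : Label) : Fin d → ℤ :=
  x + ∑ k ∈ Finset.range u.length, (ω (u.take (k + 1))).2

/-- `𝒯(Λ)`: the vertices of the tree such that the branching random walk is in `Λ` at this vertex
and at all its ancestors. -/
def killedTree {d : ℕ} (x : Fin d → ℤ) (ω : Env d) (Λ : Set (Fin d → ℤ)) : Set Label :=
  {u | u ∈ tree ω ∧ ∀ v : Label, v <+: u → position x ω v ∈ Λ}

/-- `ℙ_x(|𝒯(Λ)| > t)`; the cardinality takes values in `ℕ ∪ {∞}`, and the event contains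
`|𝒯(Λ)| = ∞`. -/
def tailProb {d : ℕ} (μ : Measure ℕ) (θ : Measure (Fin d → ℤ)) (x : Fin d → ℤ)
    (Λ : Set (Fin d → ℤ)) (t : ℝ) : ℝ≥0∞ :=
  law μ θ {ω | ENNReal.ofReal t < ((killedTree x ω Λ).encard : ℝ≥0∞)}

end BRW

end

noncomputable section

namespace BRW

/-! Let `N` be the size of the killed tree and `W(x) = β((r+1)² - ‖x‖²)` with `β = b/r⁴`. A centered
unit jump lowers the mean of `W` by exactly `β`, while criticality gives `E[(1+h)^ξ] ≤ 1 + h + K h²`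
for small `h ≥ 0`. Since `W ≤ 4βr²` in the ball, the quadratic error is at most `16K b β`. For small
`b` the drift `-β` absorbs both this error and a factor `e^{β/8}`, so `1 + W` is a supersolution
(`lintegral_pow_count_le`) and `E_x[e^{βN/8}] ≤ 1 + W(x)`. Markov's inequality for `e^{βN/8} - 1`,
whose mean is at most `4b/r²`, gives the prefactor `1/r²` as well as the decay. -/

/-! ### Decomposition of the environment at the root -/

theorem measurePreserving_root_subtrees {X : Type*} [MeasurableSpace X] (ν : Measure X)
    [IsProbabilityMeasure ν] :
    MeasurePreserving (fun (ω : Label → X) => (ω [], fun (i : ℕ) (u : Label) => ω (i :: u)))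
      (Measure.infinitePi fun _ : Label => ν)
      (ν.prod (Measure.infinitePi fun _ : ℕ => Measure.infinitePi fun _ : Label => ν)) := by
  -- Inverse of the decomposition, up to currying; its image measure is identified on finite
  -- cylinders.
  let glue : X × (ℕ × Label → X) → Label → X := fun p u =>
    match u with
    | [] => p.1
    | i :: v => p.2 (i, v)
  have hglue : Measurable glue := by
    refine measurable_pi_lambda _ fun u => ?_
    cases u with
    | nil => exact measurable_fst
    | cons i v => exact (measurable_pi_apply (i, v)).comp measurable_snd
  have key : (ν.prod (Measure.infinitePi fun _ : ℕ × Label => ν)).map glue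
      = Measure.infinitePi fun _ : Label => ν := by
    classical
    refine Measure.eq_infinitePi _ fun s t ht => ?_
    rw [Measure.map_apply hglue (.pi s.countable_toSet fun _ _ => ht _)]
    have hinj : Function.Injective fun p : ℕ × Label => p.1 :: p.2 := by
      rintro ⟨i, u⟩ ⟨j, v⟩ h
      simpa using h
    set s' : Finset (ℕ × Label) := s.preimage (fun p => p.1 :: p.2) hinj.injOn with hs'
    have hpre : glue ⁻¹' (s : Set Label).pi t
        = (if [] ∈ s then t [] else Set.univ) ×ˢ
          (s' : Set (ℕ × Label)).pi (fun p => t (p.1 :: p.2)) := by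
      ext ⟨p, η⟩
      simp only [Set.mem_preimage, Set.mem_pi, Set.mem_prod, hs', Finset.mem_coe,
        Finset.mem_preimage]
      constructor
      · intro h
        refine ⟨?_, fun q hq => h _ hq⟩
        split_ifs with h0
        · exact h _ h0
        · trivial
      · rintro ⟨h1, h2⟩ u hu
        cases u with
        | nil => simpa [hu] using h1
        | cons i v => exact h2 (i, v) hu
    rw [hpre, Measure.prod_prod, Measure.infinitePi_pi _ fun _ _ => ht _]
    have himg : s.erase [] = s'.image fun p => p.1 :: p.2 := by
      ext u
      cases u with
      | nil => simp
      | cons i v => simp [hs']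
    have hprod : ∏ p ∈ s', ν (t (p.1 :: p.2)) = ∏ u ∈ s.erase [], ν (t u) := by
      rw [himg, Finset.prod_image hinj.injOn]
    rw [hprod]
    split_ifs with h0
    · exact Finset.mul_prod_erase s (fun u => ν (t u)) h0
    · rw [measure_univ, one_mul, Finset.erase_eq_of_notMem h0]
  refine ⟨by fun_prop, ?_⟩
  conv_lhs => rw [← key]
  rw [Measure.map_map (by fun_prop) hglue]
  have hcomp : (fun (ω : Label → X) => (ω [], fun (i : ℕ) (u : Label) => ω (i :: u))) ∘ glue
      = Prod.map id (MeasurableEquiv.curry ℕ Label X) := by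
    ext p <;> rfl
  rw [hcomp, ← Measure.map_prod_map _ _ measurable_id (MeasurableEquiv.measurable _),
    Measure.map_id, Measure.infinitePi_map_curry (fun (_ : ℕ) (_ : Label) => ν)]

theorem lintegral_prod_range_infinitePi {Y : Type*} [MeasurableSpace Y] (L : Measure Y)
    [IsProbabilityMeasure L] {f : Y → ℝ≥0∞} (hf : Measurable f) (k : ℕ) :
    ∫⁻ η, ∏ i ∈ Finset.range k, f (η i) ∂(Measure.infinitePi fun _ : ℕ => L)
      = (∫⁻ y, f y ∂L) ^ k := by
  have hind : ProbabilityTheory.iIndepFun (fun (i : ℕ) (η : ℕ → Y) => f (η i))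
      (Measure.infinitePi fun _ : ℕ => L) :=
    ProbabilityTheory.iIndepFun_infinitePi (X := fun _ => f) fun _ => hf
  have h := ProbabilityTheory.lintegral_prod_eq_prod_lintegral_of_indepFun (Finset.range k)
    _ hind fun i => by fun_prop
  rw [h, Finset.prod_congr rfl fun i _ => ?_, Finset.prod_const, Finset.card_range]
  exact (measurePreserving_eval_infinitePi (fun _ : ℕ => L) i).lintegral_comp hf

/-! ### Truncated population counts -/

/-- The subtree environment seen from the child `i` of the root. -/
def shift {d : ℕ} (i : ℕ) (ω : Env d) : Env d := fun u => ω (i :: u)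

open Classical in
/-- The number of vertices of the killed tree in the first `n` generations. -/
def count {d : ℕ} (Λ : Set (Fin d → ℤ)) : ℕ → (Fin d → ℤ) → Env d → ℕ
  | 0, _, _ => 0
  | n + 1, x, ω =>
    if x ∈ Λ then
      1 + ∑ i ∈ Finset.range (ω []).1, count Λ n (x + (ω [i]).2) (shift i ω)
    else 0

theorem position_cons {d : ℕ} (x : Fin d → ℤ) (ω : Env d) (i : ℕ) (u : Label) :
    position x ω (i :: u) = position (x + (ω [i]).2) (shift i ω) u := by
  simp [position, shift, Finset.sum_range_succ', add_assoc, add_comm]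

theorem killedTree_cons {d : ℕ} {x : Fin d → ℤ} {ω : Env d} {Λ : Set (Fin d → ℤ)} {i : ℕ}
    {u : Label} (h : i :: u ∈ killedTree x ω Λ) :
    i < (ω []).1 ∧ u ∈ killedTree (x + (ω [i]).2) (shift i ω) Λ := by
  refine ⟨h.1 [] i (by simp), fun v j hv => h.1 (i :: v) j (by simpa using hv), fun v hv => ?_⟩
  rw [← position_cons]
  exact h.2 _ (by simpa using hv)

theorem root_mem_of_mem_killedTree {d : ℕ} {x : Fin d → ℤ} {ω : Env d} {Λ : Set (Fin d → ℤ)}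
    {u : Label} (h : u ∈ killedTree x ω Λ) : x ∈ Λ := by
  simpa [position] using h.2 [] (by simp)

theorem encard_killedTree_le_count {d : ℕ} (Λ : Set (Fin d → ℤ)) (n : ℕ) (x : Fin d → ℤ)
    (ω : Env d) : (killedTree x ω Λ ∩ {u | u.length < n}).encard ≤ count Λ n x ω := by
  induction n generalizing x ω with
  | zero => simp [count]
  | succ n ih =>
    by_cases hx : x ∈ Λ
    · have hsub : killedTree x ω Λ ∩ {u | u.length < n + 1} ⊆
          {[]} ∪ ⋃ i ∈ Finset.range (ω []).1, (i :: ·) ''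
            (killedTree (x + (ω [i]).2) (shift i ω) Λ ∩ {u | u.length < n}) := by
        rintro (_ | ⟨i, u⟩) ⟨hu, hl⟩
        · simp
        · right
          have := killedTree_cons hu
          simp only [Set.mem_iUnion]
          exact ⟨i, Finset.mem_range.2 this.1, u, ⟨this.2, by simpa using hl⟩, rfl⟩
      have hun : ∀ s : Finset ℕ, (⋃ i ∈ s, (i :: ·) ''
            (killedTree (x + (ω [i]).2) (shift i ω) Λ ∩ {u | u.length < n})).encard ≤
          ∑ i ∈ s, (count Λ n (x + (ω [i]).2) (shift i ω) : ℕ∞) := by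
        intro s
        induction s using Finset.induction_on with
        | empty => simp
        | insert i s hi hs =>
          rw [Finset.set_biUnion_insert, Finset.sum_insert hi]
          exact (Set.encard_union_le _ _).trans
            (add_le_add ((Set.encard_image_le _ _).trans (ih _ _)) hs)
      refine (Set.encard_le_encard hsub).trans ((Set.encard_union_le _ _).trans ?_)
      simp only [count, hx, if_true, Nat.cast_add, Nat.cast_one, Nat.cast_sum,
        Set.encard_singleton]
      gcongr
      exact hun _
    · have : killedTree x ω Λ = ∅ :=
        Set.eq_empty_of_forall_notMem fun u hu => hx (root_mem_of_mem_killedTree hu)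
      simp [this]

/-- A finite subset with `⌊t⌋₊ + 1` elements has bounded length; this covers infinite `A`. -/
theorem exists_lt_encard_inter_length {A : Set Label} {t : ℝ}
    (h : ENNReal.ofReal t < ((A.encard : ℕ∞) : ℝ≥0∞)) :
    ∃ n : ℕ, ENNReal.ofReal t < (((A ∩ {u | u.length < n}).encard : ℕ∞) : ℝ≥0∞) := by
  have hm : ((⌊t⌋₊ + 1 : ℕ) : ℕ∞) ≤ A.encard := by
    by_contra! hlt
    obtain ⟨k, hk⟩ := ENat.ne_top_iff_exists.1 hlt.ne_top
    rw [← hk] at hlt h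
    have hk1 : k ≤ ⌊t⌋₊ := by
      have : k < ⌊t⌋₊ + 1 := by exact_mod_cast hlt
      omega
    have h0 : (0 : ℝ) ≤ t ∨ k = 0 := by
      by_contra! h0
      exact h0.2 (by simpa [Nat.floor_of_nonpos h0.1.le] using hk1)
    rcases h0 with h0 | h0
    · have : (k : ℝ) ≤ t := (Nat.cast_le.2 hk1).trans (Nat.floor_le h0)
      have h3 : (k : ℝ≥0∞) ≤ ENNReal.ofReal t := by
        rw [← ENNReal.ofReal_natCast]; exact ENNReal.ofReal_le_ofReal this
      exact absurd h (not_lt.2 (by simpa using h3))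
    · simp [h0] at h
  obtain ⟨F, hFA, hF⟩ := Set.exists_subset_encard_eq hm
  have hfin : F.Finite := Set.finite_of_encard_eq_coe hF
  obtain ⟨n, hn⟩ := (hfin.image List.length).bddAbove
  refine ⟨n + 1, lt_of_lt_of_le (b := ((F.encard : ℕ∞) : ℝ≥0∞)) ?_ ?_⟩
  · rw [hF]
    have : t < ((⌊t⌋₊ + 1 : ℕ) : ℝ) := by exact_mod_cast Nat.lt_floor_add_one t
    have h2 : ENNReal.ofReal t < ENNReal.ofReal ((⌊t⌋₊ + 1 : ℕ) : ℝ) :=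
      (ENNReal.ofReal_lt_ofReal_iff (by positivity)).2 this
    rw [ENNReal.ofReal_natCast] at h2
    simpa using h2
  · have hsub : F ⊆ A ∩ {u | u.length < n + 1} := fun u hu =>
      ⟨hFA hu, Nat.lt_succ_of_le (hn ⟨u, hu, rfl⟩)⟩
    exact_mod_cast Set.encard_le_encard hsub

theorem measurable_count {d : ℕ} (Λ : Set (Fin d → ℤ)) (n : ℕ) :
    Measurable fun p : (Fin d → ℤ) × Env d => count Λ n p.1 p.2 := by
  classical
  induction n with
  | zero => exact measurable_const
  | succ n ih =>
    simp only [count]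
    refine Measurable.ite (measurable_fst (Set.to_countable Λ).measurableSet) ?_ measurable_const
    refine measurable_const.add ?_
    have hterm : ∀ i, Measurable fun p : (Fin d → ℤ) × Env d =>
        count Λ n (p.1 + (p.2 [i]).2) (shift i p.2) := fun i =>
      ih.comp (f := fun p : (Fin d → ℤ) × Env d => (p.1 + (p.2 [i]).2, shift i p.2))
        (by unfold shift; fun_prop)
    -- The random number of summands is first freed as a separate countable coordinate.
    have hk : Measurable fun p : ((Fin d → ℤ) × Env d) × ℕ =>
        ∑ i ∈ Finset.range p.2, count Λ n (p.1.1 + (p.1.2 [i]).2) (shift i p.1.2) :=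
      measurable_from_prod_countable_left fun k =>
        Finset.measurable_sum (Finset.range k) fun i _ => hterm i
    exact hk.comp (f := fun p : (Fin d → ℤ) × Env d => (p, (p.2 []).1)) (by fun_prop)

/-! ### Offspring generating function near 1 -/

theorem exists_lintegral_one_add_pow_le {μ : Measure ℕ} (hμ : IsOffspringLaw μ) :
    ∃ h₀ K : ℝ, 0 < h₀ ∧ 0 < K ∧ ∀ h : ℝ, 0 ≤ h → h ≤ h₀ →
      ∫⁻ k, ENNReal.ofReal (1 + h) ^ k ∂μ ≤ ENNReal.ofReal (1 + h + K * h ^ 2) := by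
  have := hμ.isProbabilityMeasure
  obtain ⟨a, ha, hint⟩ := hμ.exp_moment
  have hmean : Integrable (fun n : ℕ => (n : ℝ)) μ := by
    by_contra hn
    have := hμ.critical
    rw [integral_undef hn] at this
    exact zero_ne_one this
  set E := ∫ n : ℕ, Real.exp (a * n) ∂μ with hE
  have hE0 : 0 ≤ E := integral_nonneg fun n => (Real.exp_pos _).le
  -- The exponent `a` is split in two: one half dominates `e^{kh}`, the other `k²`, through `x²/2 ≤
  -- e^x` at `x = ak/2`.
  refine ⟨a / 2, 8 / a ^ 2 * E + 1, by positivity, by positivity, fun h h0 hh => ?_⟩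
  have hpt : ∀ k : ℕ, (1 + h) ^ k ≤ 1 + h * k + 8 / a ^ 2 * h ^ 2 * Real.exp (a * k) := by
    intro k
    have hk : (0 : ℝ) ≤ k := k.cast_nonneg
    have h1 : (1 + h) ^ k ≤ Real.exp (k * h) := by
      rw [Real.exp_nat_mul]
      exact pow_le_pow_left₀ (by positivity) (by linarith [Real.add_one_le_exp h]) k
    have h2 : ∀ x : ℝ, 0 ≤ x → Real.exp x ≤ 1 + x + x ^ 2 * Real.exp x := by
      intro x hx
      have e1 : 1 - x ≤ Real.exp (-x) := by linarith [Real.add_one_le_exp (-x)]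
      have e2 : (1 - x) * Real.exp x ≤ 1 := by
        calc (1 - x) * Real.exp x ≤ Real.exp (-x) * Real.exp x := by gcongr
          _ = 1 := by rw [← Real.exp_add]; simp
      nlinarith [mul_le_mul_of_nonneg_left e2 (by linarith : (0 : ℝ) ≤ 1 + x)]
    have h3 : (k : ℝ) ^ 2 ≤ 8 / a ^ 2 * Real.exp (a / 2 * k) := by
      have := Real.quadratic_le_exp_of_nonneg (x := a / 2 * k) (by positivity)
      have h4 : (a / 2 * k) ^ 2 / 2 ≤ Real.exp (a / 2 * k) := by
        have : 0 ≤ a / 2 * k := by positivity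
        linarith
      calc (k : ℝ) ^ 2 = 8 / a ^ 2 * ((a / 2 * k) ^ 2 / 2) := by field_simp; norm_num
        _ ≤ _ := by gcongr
    have h5 : Real.exp (k * h) ≤ Real.exp (a / 2 * k) := by
      apply Real.exp_le_exp.2; nlinarith
    calc (1 + h) ^ k ≤ Real.exp (k * h) := h1
      _ ≤ 1 + k * h + (k * h) ^ 2 * Real.exp (k * h) := h2 _ (by positivity)
      _ = 1 + h * k + h ^ 2 * ((k : ℝ) ^ 2 * Real.exp (k * h)) := by ring
      _ ≤ 1 + h * k + h ^ 2 * ((8 / a ^ 2 * Real.exp (a / 2 * k)) * Real.exp (a / 2 * k)) := by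
          gcongr
      _ = _ := by
          rw [mul_assoc (8 / a ^ 2), ← Real.exp_add, show a / 2 * k + a / 2 * k = a * k by ring]
          ring
  have hint' : Integrable (fun k : ℕ =>
      1 + h * (k : ℝ) + 8 / a ^ 2 * h ^ 2 * Real.exp (a * k)) μ :=
    ((integrable_const _).add (hmean.const_mul h)).add (hint.const_mul _)
  calc ∫⁻ k, ENNReal.ofReal (1 + h) ^ k ∂μ
      ≤ ∫⁻ k : ℕ, ENNReal.ofReal (1 + h * k + 8 / a ^ 2 * h ^ 2 * Real.exp (a * k)) ∂μ := by
        refine lintegral_mono fun k => ?_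
        rw [← ENNReal.ofReal_pow (by positivity)]
        exact ENNReal.ofReal_le_ofReal (hpt k)
    _ = ENNReal.ofReal (∫ k : ℕ, (1 + h * k + 8 / a ^ 2 * h ^ 2 * Real.exp (a * k)) ∂μ) :=
        (ofReal_integral_eq_lintegral_ofReal hint' (ae_of_all _ fun k => by positivity)).symm
    _ ≤ _ := by
        apply ENNReal.ofReal_le_ofReal
        rw [integral_add (f := fun k : ℕ => 1 + h * (k : ℝ))
            ((integrable_const _).add (hmean.const_mul h)) (hint.const_mul _),
          integral_add (integrable_const _) (hmean.const_mul h), integral_const_mul,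
          integral_const_mul, hμ.critical, ← hE]
        simp only [integral_const, probReal_univ, smul_eq_mul]
        nlinarith [sq_nonneg h]

/-! ### Action of a jump on the squared norm -/

theorem eucNorm_sq {d : ℕ} (z : Fin d → ℤ) : eucNorm z ^ 2 = ∑ i, (z i : ℝ) ^ 2 := by
  simp [eucNorm, EuclideanSpace.norm_sq_eq]

theorem eucNorm_nonneg {d : ℕ} (z : Fin d → ℤ) : 0 ≤ eucNorm z := norm_nonneg _

theorem eucNorm_add_le {d : ℕ} (y z : Fin d → ℤ) : eucNorm (y + z) ≤ eucNorm y + eucNorm z := by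
  refine le_trans (le_of_eq ?_) (norm_add_le _ _)
  unfold eucNorm
  congr 1
  ext i
  simp

theorem IsJumpLaw.ae_eucNorm_eq_one {d : ℕ} {θ : Measure (Fin d → ℤ)} (hθ : IsJumpLaw θ) :
    ∀ᵐ z ∂θ, eucNorm z = 1 :=
  ae_iff_of_countable.2 fun z hz => (hθ.support z).1 hz

theorem abs_coord_le_eucNorm {d : ℕ} (z : Fin d → ℤ) (i : Fin d) : |(z i : ℝ)| ≤ eucNorm z := by
  simpa [eucNorm] using
    PiLp.norm_apply_le (WithLp.toLp 2 (fun i => (z i : ℝ)) : EuclideanSpace ℝ (Fin d)) i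

theorem IsJumpLaw.integrable_coord {d : ℕ} {θ : Measure (Fin d → ℤ)} (hθ : IsJumpLaw θ)
    (i : Fin d) : Integrable (fun z : Fin d → ℤ => (z i : ℝ)) θ := by
  have := hθ.isProbabilityMeasure
  refine Integrable.of_bound (measurable_of_countable _).aestronglyMeasurable 1 ?_
  filter_upwards [hθ.ae_eucNorm_eq_one] with z hz
  exact hz ▸ abs_coord_le_eucNorm z i

theorem eucNorm_add_sq {d : ℕ} (y z : Fin d → ℤ) :
    eucNorm (y + z) ^ 2 = eucNorm y ^ 2 + ∑ i, 2 * (y i : ℝ) * z i + eucNorm z ^ 2 := by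
  simp only [eucNorm_sq, ← Finset.sum_add_distrib]
  refine Finset.sum_congr rfl fun i _ => ?_
  push_cast [Pi.add_apply]
  ring

/-- The jump kernel maps `A - β ‖·‖²` to `A - β ‖·‖² - β`. -/
theorem IsJumpLaw.lintegral_ofReal_sub_mul_sq {d : ℕ} {θ : Measure (Fin d → ℤ)}
    (hθ : IsJumpLaw θ) {A β : ℝ} {y : Fin d → ℤ}
    (hA : ∀ᵐ z ∂θ, 0 ≤ A - β * eucNorm (y + z) ^ 2) :
    ∫⁻ z, ENNReal.ofReal (A - β * eucNorm (y + z) ^ 2) ∂θ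
      = ENNReal.ofReal (A - β * eucNorm y ^ 2 - β) := by
  have := hθ.isProbabilityMeasure
  have hae : (fun z => A - β * eucNorm (y + z) ^ 2) =ᵐ[θ]
      fun z => (A - β * eucNorm y ^ 2 - β) - β * ∑ i, 2 * (y i : ℝ) * z i := by
    filter_upwards [hθ.ae_eucNorm_eq_one] with z hz
    rw [eucNorm_add_sq, hz]; ring
  have hs : Integrable (fun z : Fin d → ℤ => ∑ i, 2 * (y i : ℝ) * z i) θ :=
    integrable_finsetSum _ fun i _ => (hθ.integrable_coord i).const_mul _
  have hint := (integrable_const (μ := θ) (A - β * eucNorm y ^ 2 - β)).sub (hs.const_mul β)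
  rw [← ofReal_integral_eq_lintegral_ofReal (hint.congr hae.symm) hA, integral_congr_ae hae,
    integral_sub (integrable_const _) (hs.const_mul β), integral_const_mul,
    integral_finsetSum _ fun i _ => (hθ.integrable_coord i).const_mul _]
  simp [integral_const_mul, hθ.centered]

/-! ### Recursion and supersolution for exponential moments -/

variable {d : ℕ} {μ : Measure ℕ} {θ : Measure (Fin d → ℤ)}

-- Letting the start depend on the root's data through `g` covers both a fixed start and one
-- displaced by the root's own jump, which is how a child's subtree appears.
open Classical in
theorem lintegral_pow_count_succ_aux [IsProbabilityMeasure μ] [IsProbabilityMeasure θ]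
    (Λ : Set (Fin d → ℤ)) (q : ℝ≥0∞) (n : ℕ) (g : ℕ × (Fin d → ℤ) → (Fin d → ℤ)) :
    ∫⁻ ω, q ^ count Λ (n + 1) (g (ω [])) ω ∂law μ θ
      = ∫⁻ p, (if g p ∈ Λ then
          q * (∫⁻ ω, q ^ count Λ n (g p + (ω []).2) ω ∂law μ θ) ^ p.1 else 1) ∂μ.prod θ := by
  have hcount : ∀ x, Measurable fun ω : Env d => q ^ count Λ n (x + (ω []).2) ω := fun x =>
    (measurable_of_countable fun m : ℕ => q ^ m).comp
      ((measurable_count Λ n).comp (f := fun ω : Env d => (x + (ω []).2, ω)) (by fun_prop))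
  let F : (ℕ × (Fin d → ℤ)) × (ℕ → Env d) → ℝ≥0∞ := fun s =>
    if g s.1 ∈ Λ then
      q * ∏ i ∈ Finset.range s.1.1, q ^ count Λ n (g s.1 + (s.2 i []).2) (s.2 i) else 1
  have hF : Measurable F := by
    refine measurable_from_prod_countable_right fun p => ?_
    by_cases hp : g p ∈ Λ
    · simp only [F, hp, if_true]
      exact (Finset.measurable_prod _ fun i _ =>
        (hcount (g p)).comp (measurable_pi_apply i)).const_mul q
    · simp only [F, hp, if_false]
      exact measurable_const
  have hFc : ∀ ω : Env d, q ^ count Λ (n + 1) (g (ω [])) ω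
      = F (ω [], fun (i : ℕ) (u : Label) => ω (i :: u)) := by
    intro ω
    by_cases hp : g (ω []) ∈ Λ
    · simp only [F, count, hp, if_true, pow_add, pow_one, Finset.prod_pow_eq_pow_sum]
      rfl
    · simp [F, count, hp]
  have hprob : IsProbabilityMeasure (law μ θ) := by unfold law; infer_instance
  simp_rw [hFc]
  have := (measurePreserving_root_subtrees (μ.prod θ)).lintegral_comp hF
  rw [law, this, lintegral_prod _ hF.aemeasurable]
  refine lintegral_congr fun p => ?_
  by_cases hp : g p ∈ Λ
  · simp only [F, hp, if_true]
    have hm : Measurable fun η : ℕ → Env d =>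
        ∏ i ∈ Finset.range p.1, q ^ count Λ n (g p + (η i []).2) (η i) :=
      Finset.measurable_prod _ fun i _ => (hcount (g p)).comp (measurable_pi_apply i)
    refine (lintegral_const_mul q hm).trans ?_
    congr 1
    exact lintegral_prod_range_infinitePi (law μ θ) (hcount (g p)) p.1
  · simp [F, hp]

/-- Branching property: the exponential moment of the total population satisfies the recursion
given by the generating function of the offspring law. -/
theorem lintegral_pow_count_succ [IsProbabilityMeasure μ] [IsProbabilityMeasure θ]
    (Λ : Set (Fin d → ℤ)) (q : ℝ≥0∞) (n : ℕ) {x : Fin d → ℤ} (hx : x ∈ Λ) :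
    ∫⁻ ω, q ^ count Λ (n + 1) x ω ∂law μ θ
      = q * ∫⁻ k, (∫⁻ ω, q ^ count Λ n (x + (ω []).2) ω ∂law μ θ) ^ k ∂μ := by
  rw [lintegral_pow_count_succ_aux Λ q n fun _ => x]
  simp only [hx, if_true]
  rw [lintegral_prod _ (measurable_of_countable _).aemeasurable]
  simp only [lintegral_const, measure_univ, mul_one]
  exact lintegral_const_mul _ (measurable_of_countable _)

/-- The jump carried by the root is independent of the descent of the root. -/
theorem lintegral_pow_count_add_root [IsProbabilityMeasure μ] [IsProbabilityMeasure θ]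
    (Λ : Set (Fin d → ℤ)) (q : ℝ≥0∞) (n : ℕ) (y : Fin d → ℤ) :
    ∫⁻ ω, q ^ count Λ n (y + (ω []).2) ω ∂law μ θ
      = ∫⁻ z, ∫⁻ ω, q ^ count Λ n (y + z) ω ∂law μ θ ∂θ := by
  have hprob : IsProbabilityMeasure (law μ θ) := by unfold law; infer_instance
  cases n with
  | zero => simp [count]
  | succ n =>
    rw [lintegral_pow_count_succ_aux Λ q n fun p => y + p.2,
      lintegral_prod_symm _ (measurable_of_countable _).aemeasurable]
    refine lintegral_congr fun z => ?_
    by_cases hz : y + z ∈ Λ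
    · simp only [hz, if_true]
      rw [lintegral_pow_count_succ Λ q n hz]
      exact lintegral_const_mul _ (measurable_of_countable _)
    · simp [hz, count]

/-- Supersolution estimate: `1 + β ((r + 1)² - ‖x‖²)` dominates the exponential moment. -/
theorem lintegral_pow_count_le (hθ : IsJumpLaw θ) [IsProbabilityMeasure μ] {r β lam : ℝ}
    (hβ : 0 ≤ β)
    (hsuper : ∀ x ∈ ball d r, ENNReal.ofReal (Real.exp lam) *
      ∫⁻ k, ENNReal.ofReal (1 + (β * ((r + 1) ^ 2 - eucNorm x ^ 2) - β)) ^ k ∂μ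
        ≤ ENNReal.ofReal (1 + β * ((r + 1) ^ 2 - eucNorm x ^ 2)))
    (n : ℕ) (x : Fin d → ℤ) (hx : eucNorm x < r + 1) :
    ∫⁻ ω, ENNReal.ofReal (Real.exp lam) ^ count (ball d r) n x ω ∂law μ θ
      ≤ ENNReal.ofReal (1 + β * ((r + 1) ^ 2 - eucNorm x ^ 2)) := by
  have := hθ.isProbabilityMeasure
  have hprob : IsProbabilityMeasure (law μ θ) := by unfold law; infer_instance
  -- Jumps out of the ball land within radius `r + 1`; there the count vanishes, so the
  -- supersolution need only be at least 1.
  have hone : ∀ x : Fin d → ℤ, eucNorm x < r + 1 →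
      (1 : ℝ) ≤ 1 + β * ((r + 1) ^ 2 - eucNorm x ^ 2) := fun x hx => by
    have : eucNorm x ^ 2 ≤ (r + 1) ^ 2 := pow_le_pow_left₀ (eucNorm_nonneg x) hx.le 2
    nlinarith [mul_nonneg hβ (sub_nonneg.2 this)]
  induction n generalizing x with
  | zero => simpa [count] using hone x hx
  | succ n ih =>
    by_cases hxB : x ∈ ball d r
    · rw [lintegral_pow_count_succ _ _ _ hxB]
      refine le_trans ?_ (hsuper x hxB)
      gcongr with k
      rw [lintegral_pow_count_add_root]
      have hnbr : ∀ᵐ z ∂θ, eucNorm (x + z) < r + 1 := by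
        filter_upwards [hθ.ae_eucNorm_eq_one] with z hz
        have : eucNorm x < r := hxB
        linarith [eucNorm_add_le x z]
      calc ∫⁻ z, ∫⁻ ω, ENNReal.ofReal (Real.exp lam) ^ count (ball d r) n (x + z) ω ∂law μ θ ∂θ
          ≤ ∫⁻ z, ENNReal.ofReal ((1 + β * (r + 1) ^ 2) - β * eucNorm (x + z) ^ 2) ∂θ := by
            refine lintegral_mono_ae ?_
            filter_upwards [hnbr] with z hz
            refine (ih _ hz).trans (le_of_eq ?_)
            congr 1; ring
        _ = ENNReal.ofReal ((1 + β * (r + 1) ^ 2) - β * eucNorm x ^ 2 - β) := by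
            refine hθ.lintegral_ofReal_sub_mul_sq ?_
            filter_upwards [hnbr] with z hz
            linarith [hone _ hz]
        _ ≤ _ := le_of_eq (by congr 1; ring)
    · simpa [count, hxB] using hone x hx

/-! ### From exponential moments to tails -/

/-- Exponential Markov inequality for `e^{lam N} - 1`. -/
theorem measure_lt_natCast_le {Ω : Type*} [MeasurableSpace Ω] {P : Measure Ω}
    [IsProbabilityMeasure P] {N : Ω → ℕ} (hN : Measurable N) {lam t s : ℝ} (hlam : 0 < lam)
    (ht : 0 < t) (hs : 0 ≤ s)
    (h : ∫⁻ ω, ENNReal.ofReal (Real.exp lam) ^ N ω ∂P ≤ ENNReal.ofReal (1 + s)) :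
    P {ω | ENNReal.ofReal t < (N ω : ℝ≥0∞)} ≤ ENNReal.ofReal (s / (Real.exp (lam * t) - 1)) := by
  have hpos : 0 < Real.exp (lam * t) - 1 := by
    have := Real.add_one_lt_exp (mul_pos hlam ht).ne'
    nlinarith [mul_pos hlam ht]
  have hf : Measurable fun ω => ENNReal.ofReal (Real.exp lam) ^ N ω - 1 :=
    (measurable_of_countable fun m : ℕ => ENNReal.ofReal (Real.exp lam) ^ m - 1).comp hN
  have hone : ∀ ω, 1 ≤ ENNReal.ofReal (Real.exp lam) ^ N ω := fun ω =>
    one_le_pow₀ (by simpa using hlam.le)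
  have hint : ∫⁻ ω, (ENNReal.ofReal (Real.exp lam) ^ N ω - 1) ∂P ≤ ENNReal.ofReal s := by
    rw [lintegral_sub measurable_const (by simp) (ae_of_all _ hone)]
    simp only [lintegral_one, measure_univ]
    rw [tsub_le_iff_right]
    refine h.trans ?_
    rw [add_comm, ENNReal.ofReal_add hs zero_le_one, ENNReal.ofReal_one]
  rw [ENNReal.ofReal_div_of_pos hpos, ENNReal.le_div_iff_mul_le
      (Or.inl (ENNReal.ofReal_pos.2 hpos).ne') (Or.inl ENNReal.ofReal_ne_top),
    mul_comm]
  refine le_trans ?_ ((mul_meas_ge_le_lintegral hf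
    (ENNReal.ofReal (Real.exp (lam * t) - 1))).trans hint)
  gcongr
  intro (hω : _ < _)
  rw [← ENNReal.ofReal_natCast, ENNReal.ofReal_lt_ofReal_iff_of_nonneg ht.le] at hω
  rw [ENNReal.ofReal_sub _ zero_le_one, ENNReal.ofReal_one]
  refine tsub_le_tsub_right ?_ 1
  rw [← ENNReal.ofReal_pow (Real.exp_pos _).le, ← Real.exp_nat_mul]
  exact ENNReal.ofReal_le_ofReal (Real.exp_le_exp.2 (by nlinarith))

/-- Continuity from below along the generations; for increasing events it needs no measurability. -/
theorem tailProb_le_of_forall_count [IsProbabilityMeasure (law μ θ)] (Λ : Set (Fin d → ℤ))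
    (x : Fin d → ℤ) (t : ℝ) {B : ℝ≥0∞}
    (h : ∀ n, law μ θ {ω | ENNReal.ofReal t < (count Λ n x ω : ℝ≥0∞)} ≤ B) :
    tailProb μ θ x Λ t ≤ B := by
  let A : ℕ → Set (Env d) := fun n => {ω | ENNReal.ofReal t <
    (((killedTree x ω Λ ∩ {u | u.length < n}).encard : ℕ∞) : ℝ≥0∞)}
  have hA : Monotone A := by
    intro m n hmn ω hω
    have hsub : killedTree x ω Λ ∩ {u | u.length < m} ⊆ killedTree x ω Λ ∩ {u | u.length < n} :=
      Set.inter_subset_inter_right _ fun u (hu : _ < _) => hu.trans_le hmn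
    rw [Set.mem_ofPred_eq] at hω ⊢
    refine lt_of_lt_of_le hω ?_
    exact_mod_cast Set.encard_le_encard hsub
  have hsub : {ω | ENNReal.ofReal t < ((killedTree x ω Λ).encard : ℝ≥0∞)} ⊆ ⋃ n, A n :=
    fun ω hω => Set.mem_iUnion.2 (exists_lt_encard_inter_length hω)
  refine (measure_mono hsub).trans ?_
  rw [hA.measure_iUnion]
  refine iSup_le fun n => (measure_mono fun ω hω => ?_).trans (h n)
  rw [Set.mem_ofPred_eq] at hω ⊢
  refine lt_of_lt_of_le hω ?_
  have := ENat.toENNReal_le.2 (encard_killedTree_le_count Λ n x ω)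
  simpa using this

end BRW

end

/-! ### Choice of constants and conclusion -/

theorem proposition5 (d : ℕ) (hd : 1 ≤ d)
    (μ : MeasureTheory.Measure ℕ) (hμ : BRW.IsOffspringLaw μ)
    (θ : MeasureTheory.Measure (Fin d → ℤ)) (hθ : BRW.IsJumpLaw θ) :
    ∃ c C : ℝ, 0 < c ∧ 0 < C ∧
      ∀ r : ℝ, 1 ≤ r → ∀ t : ℝ, r ^ 4 ≤ t →
        (⨆ x ∈ BRW.ball d r, BRW.tailProb μ θ x (BRW.ball d r) t)
          ≤ ENNReal.ofReal (C / r ^ 2 * Real.exp (-(c * t / r ^ 4))) := by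
  have := hμ.isProbabilityMeasure
  have := hθ.isProbabilityMeasure
  have hprob : IsProbabilityMeasure (BRW.law μ θ) := by unfold BRW.law; infer_instance
  obtain ⟨h₀, K, hh₀, hK, hgen⟩ := BRW.exists_lintegral_one_add_pow_le hμ
  -- As `W ≤ 4b`, these keep `W - β` in the range of `hgen`, make the quadratic error at most `β/2`,
  -- and give `W ≤ 1`.
  obtain ⟨b, hb, hb1, hb2, hb3⟩ : ∃ b : ℝ, 0 < b ∧ 4 * b ≤ h₀ ∧ 32 * K * b ≤ 1 ∧ 4 * b ≤ 1 := by
    refine ⟨min (h₀ / 4) (min (1 / (32 * K)) (1 / 4)), by positivity, ?_, ?_, ?_⟩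
    · linarith [min_le_left (h₀ / 4) (min (1 / (32 * K)) (1 / 4))]
    · rw [← le_div_iff₀' (by positivity)]
      exact (min_le_right _ _).trans (min_le_left _ _)
    · linarith [(min_le_right (h₀ / 4) (min (1 / (32 * K)) (1 / 4))).trans (min_le_right _ _)]
  have hD : 0 < 1 - Real.exp (-(b / 8)) := by
    have : Real.exp (-(b / 8)) < 1 := by simpa using hb
    linarith
  refine ⟨b / 8, 4 * b / (1 - Real.exp (-(b / 8))), by positivity, by positivity,
    fun r hr t ht => iSup₂_le fun x hx => ?_⟩
  have hr0 : 0 < r := by linarith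
  have hr4 : 1 ≤ r ^ 4 := one_le_pow₀ hr
  set β := b / r ^ 4 with hβ
  have hβ0 : 0 < β := by positivity
  have hβr : β * r ^ 4 = b := by rw [hβ]; field_simp
  have hβb : β ≤ b := div_le_self hb.le hr4
  have hr24 : r ^ 2 ≤ r ^ 4 := pow_le_pow_right₀ hr (by norm_num)
  have hball : ∀ y ∈ BRW.ball d r, β ≤ β * ((r + 1) ^ 2 - BRW.eucNorm y ^ 2) ∧
      β * ((r + 1) ^ 2 - BRW.eucNorm y ^ 2) ≤ 4 * (β * r ^ 2) := by
    intro y hy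
    have h1 : BRW.eucNorm y < r := hy
    have h2 := BRW.eucNorm_nonneg y
    constructor
    · exact le_mul_of_one_le_right hβ0.le (by nlinarith)
    · rw [show 4 * (β * r ^ 2) = β * (4 * r ^ 2) by ring]
      gcongr
      nlinarith
  have hsuper : ∀ y ∈ BRW.ball d r, ENNReal.ofReal (Real.exp (β / 8)) *
      ∫⁻ k, ENNReal.ofReal (1 + (β * ((r + 1) ^ 2 - BRW.eucNorm y ^ 2) - β)) ^ k ∂μ
        ≤ ENNReal.ofReal (1 + β * ((r + 1) ^ 2 - BRW.eucNorm y ^ 2)) := by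
    intro y hy
    obtain ⟨hW1, hW2⟩ := hball y hy
    set W := β * ((r + 1) ^ 2 - BRW.eucNorm y ^ 2)
    have hβr2 : β * r ^ 2 ≤ b := hβr ▸ by gcongr
    have hquad : K * (W - β) ^ 2 ≤ β / 2 := by
      calc K * (W - β) ^ 2 ≤ K * (4 * (β * r ^ 2)) ^ 2 := by
            gcongr
            · linarith
        _ = 16 * K * (β * r ^ 4) * β := by ring
        _ = (32 * K * b) * (β / 2) := by rw [hβr]; ring
        _ ≤ 1 * (β / 2) := by gcongr
        _ = β / 2 := one_mul _
    have hexp : Real.exp (β / 8) ≤ 1 + β / 4 := by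
      have h1 := Real.abs_exp_sub_one_le (x := β / 8) (by rw [abs_of_pos] <;> linarith)
      rw [abs_of_pos (by positivity : 0 < β / 8)] at h1
      linarith [le_abs_self (Real.exp (β / 8) - 1)]
    refine (mul_le_mul_right (hgen _ (by linarith) (by linarith)) _).trans ?_
    rw [← ENNReal.ofReal_mul (Real.exp_pos _).le]
    apply ENNReal.ofReal_le_ofReal
    calc Real.exp (β / 8) * (1 + (W - β) + K * (W - β) ^ 2)
        ≤ (1 + β / 4) * (1 + (W - β) + β / 2) := by
          gcongr
      -- The drift leaves `-β/2`; the factor `1 + β/4` costs at most `β/4 + βW/4 ≤ β/2`.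
      _ ≤ 1 + W := by nlinarith
  have hx' : BRW.eucNorm x < r + 1 := by
    have : BRW.eucNorm x < r := hx
    linarith
  have ht0 : 0 < t := by linarith
  refine BRW.tailProb_le_of_forall_count _ _ _ fun n => ?_
  have hmom := BRW.lintegral_pow_count_le hθ hβ0.le hsuper n x hx'
  refine (BRW.measure_lt_natCast_le
    ((BRW.measurable_count (BRW.ball d r) n).comp measurable_prodMk_left)
    (by positivity : 0 < β / 8) ht0 (hβ0.le.trans (hball x hx).1) hmom).trans ?_
  apply ENNReal.ofReal_le_ofReal
  -- Here `t ≥ r⁴` enters: it keeps `e^{βt/8} - 1` comparable to `e^{βt/8}`.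
  have hbt : b / 8 ≤ β / 8 * t := by
    rw [← hβr]
    nlinarith
  have hden : (1 - Real.exp (-(b / 8))) * Real.exp (β / 8 * t) ≤ Real.exp (β / 8 * t) - 1 := by
    have : Real.exp (-(b / 8)) * Real.exp (β / 8 * t) ≥ 1 := by
      rw [← Real.exp_add]
      exact Real.one_le_exp (by linarith)
    linarith
  calc β * ((r + 1) ^ 2 - BRW.eucNorm x ^ 2) / (Real.exp (β / 8 * t) - 1)
      ≤ 4 * (β * r ^ 2) / ((1 - Real.exp (-(b / 8))) * Real.exp (β / 8 * t)) := by
        have := (hball x hx).2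
        refine div_le_div₀ (by positivity) this (by positivity) hden
    _ = _ := by
        rw [show -(b / 8 * t / r ^ 4) = -(β / 8 * t) by rw [hβ]; ring, Real.exp_neg (β / 8 * t),
          show β * r ^ 2 = b / r ^ 2 by rw [hβ]; field_simp]
        have := hD.ne'
        have := (Real.exp_pos (β / 8 * t)).ne'
        generalize Real.exp (β / 8 * t) = e at *
        generalize 1 - Real.exp (-(b / 8)) = D at *
        field_simp
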